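/- A tournament on $n$ vertices is an orientation of the complete graph; the scores of its vertices (the numbers of outgoing arrows), listed in nondecreasing order, form its score sequence $s=(s_0,\dots,s_{n-1})$. Let $S_n$ be the set of score sequences of length $n$ (so $|S_0|=1$), and let $S^{\mathrm{pt}}_n=S_n\times\{0,\dots,n-1\}$. Let $\mathrm{EGZ}_n$ ($n\ge 1$) be the set of multisets of size $n$ with elements in $\mathbb{Z}_n=\mathbb{Z}/n\mathbb{Z}$ whose sum is $\binom n2$ modulo $n$. For $(s,i)\in S^{\mathrm{pt}}_n$ let $|s^{-1}(i)|$ be the number of occurrences of $i$ in $s$, and for $M\in\mathrm{EGZ}_n$ let $|M|_0$ be the multiplicity of $0$ in $M$. Put $$S^{\mathrm{pt}}(x,t)=\sum_{n\ge1}\ \sum_{(s,i)\in S^{\mathrm{pt}}_n}t^{|s^{-1}(i)|}x^n,\qquad \mathrm{EGZ}(x,t)=\sum_{n\ge1}\ \sum_{M\in\mathrm{EGZ}_n}t^{|M|_0}x^n,\qquad S(x)=\sum_{n\ge0}|S_n|x^n .$$ Then, as formal power series in $x$ over $\mathbb{Z}[t]$, $$S^{\mathrm{pt}}(x,t)=\mathrm{EGZ}(x,t)\,S(x).$$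 Moreover, this factorization is realized by an explicit bijection. For sequences $u,v$ with $u$ of length $|u|$, let $u\oplus v$ be the concatenation of $u$ with the sequence obtained from $v$ by adding $|u|$ to each letter. A score sequence is strong if it is the score sequence of a nonempty strongly connected tournament. Every score sequence $s$ can be written in exactly one way as $s=t_1\oplus\cdots\oplus t_k$ with all $t_l$ strong. For $(s,i)\in S^{\mathrm{pt}}_n$ let $j$ be the smallest index with $i<|t_1\oplus\cdots\oplus t_j|$, put $u=t_1\oplus\cdots\oplus t_j$ and $v=t_{j+1}\oplus\cdots\oplus t_k$, and let $\Phi(s,i)=(M,v)$, where $M$ is the multiset $\{u_0-i,\dots,u_{|u|-1}-i\}$ in $\mathbb{Z}_{|u|}$. Then, for every $n$, $\Phi$ is a bijection $$\Phi:\ S^{\mathrm{pt}}_n\to\bigcup_{k=1}^n\mathrm{EGZ}_k\times S_{n-k},$$ and if $\Phi(s,i)=(M,v)$ then $|M|_0=|s^{-1}(i)|$. -/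

import Mathlib

namespace ScoreSeq

/-- A tournament: an orientation of the complete graph. There are no loops, and between any two
distinct vertices exactly one of the two possible arrows is present. -/
def IsTournament {V : Type*} (G : Digraph V) : Prop :=
  (∀ v, ¬ G.Adj v v) ∧ ∀ v w, v ≠ w → (G.Adj v w ↔ ¬ G.Adj w v)

open Classical in
/-- The score of a vertex (number of wins): the number of its outgoing arrows. -/
noncomputable def score {V : Type*} [Fintype V] (G : Digraph V) (v : V) : ℕ :=
  (Finset.univ.filter fun w => G.Adj v w).card

/-- The scores of all the vertices (with repetitions), listed in nondecreasing order. -/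
noncomputable def scoreSequence {V : Type*} [Fintype V] (G : Digraph V) : List ℕ :=
  ((Finset.univ : Finset V).val.map (score G)).sort (· ≤ ·)

open Classical in
/-- The finite set `S_n` of score sequences of tournaments with `n` vertices. -/
noncomputable def S (n : ℕ) : Finset (List ℕ) :=
  ((Finset.univ : Finset (Digraph (Fin n))).filter IsTournament).image scoreSequence

/-- A digraph is strongly connected if it is nonempty and there is a directed path from every
vertex to every vertex. -/
def StronglyConnected {V : Type*} (G : Digraph V) : Prop :=
  Nonempty V ∧ ∀ v w, Relation.ReflTransGen G.Adj v w

/-- A strong score sequence: the score sequence of a strongly connected tournament. -/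
def IsStrong (s : List ℕ) : Prop :=
  ∃ (n : ℕ) (G : Digraph (Fin n)), IsTournament G ∧ StronglyConnected G ∧ scoreSequence G = s

/-- The direct sum `u ⊕ v`: add the length of `u` to all letters of `v`, then concatenate. -/
def directSum (u v : List ℕ) : List ℕ :=
  u ++ v.map (fun a => a + u.length)

/-- The iterated direct sum `t₁ ⊕ t₂ ⊕ ⋯ ⊕ t_k` (the empty sequence if `k = 0`). -/
def directSums (ts : List (List ℕ)) : List ℕ :=
  ts.foldr directSum []

/-- `ts` is a decomposition of `s` into a direct sum of strong score sequences. -/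
def IsStrongDecomposition (s : List ℕ) (ts : List (List ℕ)) : Prop :=
  (∀ t ∈ ts, IsStrong t) ∧ directSums ts = s

/-- The list of the strong summands of `s`. -/
noncomputable def strongSummands (s : List ℕ) : List (List ℕ) :=
  Classical.epsilon (IsStrongDecomposition s)

/-- The set `S_n × [0, n-1]` of pointed score sequences. -/
noncomputable def Spt (n : ℕ) : Finset (List ℕ × ℕ) :=
  S n ×ˢ Finset.range n

/-- `EGZ_n`: the multisets of size `n` in `ℤ/nℤ` whose sum is `n choose 2` modulo `n`. -/
def egzSet (n : ℕ) : Set (Multiset (ZMod n)) :=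
  {M | M.card = n ∧ M.sum = (n.choose 2 : ZMod n)}

theorem egzSet_finite (n : ℕ) : (egzSet n).Finite := by
  rcases Nat.eq_zero_or_pos n with rfl | hn
  · refine (Set.finite_singleton (0 : Multiset (ZMod 0))).subset ?_
    intro M hM
    exact Multiset.card_eq_zero.mp hM.1
  · have : NeZero n := ⟨hn.ne'⟩
    refine (Set.finite_range (fun m : Sym (ZMod n) n => (m : Multiset (ZMod n)))).subset ?_
    intro M hM
    exact ⟨⟨M, hM.1⟩, rfl⟩

/-- `EGZ_n` as a finite set. -/
noncomputable def EGZ (n : ℕ) : Finset (Multiset (ZMod n)) :=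
  (egzSet_finite n).toFinset

/-- The polynomial `S^pt_n(t) = ∑ t ^ |s⁻¹(i)|`, the sum being over the pointed score sequences
`(s, i)` of length `n`. -/
noncomputable def SptPoly (n : ℕ) : Polynomial ℤ :=
  ∑ p ∈ Spt n, Polynomial.X ^ (p.1.count p.2)

/-- The polynomial `EGZ_n(t) = ∑ t ^ |M|₀`, where `|M|₀` is the multiplicity of `0` in `M`. -/
noncomputable def EGZPoly (n : ℕ) : Polynomial ℤ :=
  ∑ M ∈ EGZ n, Polynomial.X ^ (M.count 0)

/-- `S^pt(x,t) = ∑_{n ≥ 1} S^pt_n(t) xⁿ`, a power series in `x` over the polynomials in `t`. -/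
noncomputable def SptGF : PowerSeries (Polynomial ℤ) :=
  PowerSeries.mk fun n => if n = 0 then 0 else SptPoly n

/-- `EGZ(x,t) = ∑_{n ≥ 1} EGZ_n(t) xⁿ`, a power series in `x` over the polynomials in `t`. -/
noncomputable def EGZGF : PowerSeries (Polynomial ℤ) :=
  PowerSeries.mk fun n => if n = 0 then 0 else EGZPoly n

/-- `S(x) = ∑_{n ≥ 0} |S_n| xⁿ`. -/
noncomputable def SGF : PowerSeries ℤ :=
  PowerSeries.mk fun n => ((S n).card : ℤ)

/-- The multiset `μ(u - i) = {u₀ - i, u₁ - i, …}` in the cyclic group of order `|u|`. -/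
def mu (u : List ℕ) (i : ℕ) : Multiset (ZMod u.length) :=
  ((u.map fun a => (a : ZMod u.length) - (i : ZMod u.length) : List (ZMod u.length)) :
    Multiset (ZMod u.length))

/-- The smallest `j` with `i < |t₁ ⊕ ⋯ ⊕ t_j|`, where `t₁, t₂, …` are the strong summands
of `s`. -/
noncomputable def cutIndex (s : List ℕ) (i : ℕ) : ℕ :=
  sInf {j : ℕ | i < (directSums ((strongSummands s).take j)).length}

/-- The part `u = t₁ ⊕ ⋯ ⊕ t_j` of `s`, with `j` the cut index. -/
noncomputable def leftPart (s : List ℕ) (i : ℕ) : List ℕ :=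
  directSums ((strongSummands s).take (cutIndex s i))

/-- The part `v = t_{j+1} ⊕ ⋯ ⊕ t_k` of `s`, with `j` the cut index. -/
noncomputable def rightPart (s : List ℕ) (i : ℕ) : List ℕ :=
  directSums ((strongSummands s).drop (cutIndex s i))

/-- The map `Φ(s, i) = (μ(u - i), v)`. The modulus `k = |u|` is recorded in the value. -/
noncomputable def Phi (p : List ℕ × ℕ) : Σ k : ℕ, Multiset (ZMod k) × List ℕ :=
  ⟨(leftPart p.1 p.2).length, mu (leftPart p.1 p.2) p.2, rightPart p.1 p.2⟩

/-- The disjoint union of the sets `EGZ_k × S_{n-k}` for `1 ≤ k ≤ n`. -/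
def PhiTarget (n : ℕ) : Set (Σ k : ℕ, Multiset (ZMod k) × List ℕ) :=
  {q | 1 ≤ q.1 ∧ q.1 ≤ n ∧ q.2.1 ∈ EGZ q.1 ∧ q.2.2 ∈ S (n - q.1)}

end ScoreSeq

/-!
The proof replaces tournaments by Landau's criterion: a nondecreasing sequence `s` of length `n` is
a score sequence iff every prefix of length `m` has sum at least
`m.choose 2`, with equality for `m = n`. Necessity counts the arrows inside a set of vertices;
sufficiency is Hall's marriage theorem, matching each pair of vertices with a "win slot" of one of
the two vertices. A score sequence is strong iff it is nonempty and all proper nonempty prefixes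
satisfy the inequality strictly (`isStrong_iff`). So the strong summands are cut out by the
positions where the inequality is an equality, which gives existence and uniqueness of the
decomposition, and the part `u` of `s` used by `Φ` is the only left summand of `s` such that `i`
lies in the last strong summand of `u` (`PointsToLast`).

The bijection then amounts to a cycle lemma: for every `M ∈ EGZ_k` there is exactly one pair
`(u, i)` with `u` a score sequence of length `k`, `i` pointing into its last strong summand, and
`u - i` equal to `M` modulo `k`.

* Uniqueness (`PointsToLast.eq_of_residues_eq`): if `(u, i)` and `(u', i + d)` have the same
  residues, then `u'` is obtained from `u` by adding `d` to all letters, reducing modulo `k` and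
  sorting, that is, by moving the large letters of `u` to the front. Equality of the sums forces
  exactly `d` letters to move, and comparing prefix sums of `u` and `u'` shows that the prefix of
  `u` of length `k - d` is tight; for `d > 0` this puts `i` at or after `k - d`, so `i + d ≥ k`.
* Existence (`exists_pointsToLast_residues_eq`): extend the sorted representatives of `M` to a
  monotone `w : ℕ → ℕ` with `w (j + k) = w j + k`. The condition on the sum of `M` says that the
  average of `w j - j` over a period is an integer `e`, so `f m = ∑_{j < m} (w j - j - e)` is
  periodic. Reading `w` from a minimum of `f` gives prefix sums satisfying Landau's inequalities,
  and taking the first minimum in a suitable window of length `k` makes `i` point to the last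
  strong summand.
-/

namespace ScoreSeq

/-! ### Scores of tournaments and Landau's theorem -/

open Classical in
/-- The scores of a set `A` of vertices add up to the number of arrows inside `A`, which is
`A.card.choose 2`, plus the number of arrows leaving `A`. -/
theorem IsTournament.sum_score {V : Type*} [Fintype V] {G : Digraph V} (hG : IsTournament G)
    (A : Finset V) :
    ∑ v ∈ A, score G v =
      A.card.choose 2 + ∑ v ∈ A, (Finset.univ.filter fun w => w ∉ A ∧ G.Adj v w).card := by
  have hsplit : ∀ v, score G v = (A.filter fun w => G.Adj v w).card
      + (Finset.univ.filter fun w => w ∉ A ∧ G.Adj v w).card := by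
    intro v
    rw [score, ← Finset.card_filter_add_card_filter_not (s := Finset.univ.filter fun w => G.Adj v w)
      (fun w => w ∈ A)]
    congr 2 <;> ext w <;> simp [and_comm]
  rw [Finset.sum_congr rfl fun v _ => hsplit v, Finset.sum_add_distrib]
  congr 1
  have h2 : 2 * ∑ v ∈ A, (A.filter fun w => G.Adj v w).card = A.card * (A.card - 1) := by
    simp only [Finset.card_filter]
    have hc : ∑ v ∈ A, ∑ w ∈ A, (if G.Adj v w then 1 else 0) =
        ∑ v ∈ A, ∑ w ∈ A, (if G.Adj w v then 1 else 0) := Finset.sum_comm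
    rw [two_mul]
    nth_rw 2 [hc]
    rw [← Finset.sum_add_distrib]
    have : ∀ v ∈ A, ((∑ w ∈ A, if G.Adj v w then 1 else 0) + ∑ w ∈ A, if G.Adj w v then 1 else 0)
        = A.card - 1 := by
      intro v hv
      rw [← Finset.sum_add_distrib, ← Finset.card_erase_of_mem hv, Finset.card_eq_sum_ones,
        ← Finset.add_sum_erase _ _ hv]
      rw [if_neg (hG.1 v), add_zero, zero_add]
      refine Finset.sum_congr rfl fun w hw => ?_
      have := hG.2 v w (Finset.ne_of_mem_erase hw).symm
      by_cases h : G.Adj w v <;> simp [this, h]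
    rw [Finset.sum_congr rfl this, Finset.sum_const, smul_eq_mul]
  rw [Nat.choose_two_right, ← h2]
  omega

theorem IsTournament.choose_two_le_sum_score {V : Type*} [Fintype V] {G : Digraph V}
    (hG : IsTournament G) (A : Finset V) : A.card.choose 2 ≤ ∑ v ∈ A, score G v := by
  rw [hG.sum_score A]
  exact Nat.le_add_right _ _

/-- Equality in the bound on the sum of the scores of `A` means that no arrow leaves `A`. -/
theorem IsTournament.sum_score_eq_choose_two_iff {V : Type*} [Fintype V] {G : Digraph V}
    (hG : IsTournament G) (A : Finset V) :
    ∑ v ∈ A, score G v = A.card.choose 2 ↔ ∀ v ∈ A, ∀ w, G.Adj v w → w ∈ A := by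
  classical
  rw [hG.sum_score A, Nat.add_eq_left, Finset.sum_eq_zero_iff]
  refine forall₂_congr fun v _ => ?_
  rw [Finset.card_eq_zero, Finset.filter_eq_empty_iff]
  simp only [Finset.mem_univ, true_imp_iff, not_and]
  exact forall_congr' fun w => by tauto

/-- Landau's condition is sufficient, in the form of a condition on all sets of vertices. Vertex `v`
offers `f v` slots, and Hall's theorem assigns to each pair of vertices a slot of one of them, the
winner. Hall's condition holds because the pairs in a family `E` number at most
`U.card.choose 2`, where `U` is the set of vertices that they cover. -/
theorem exists_tournament_of_choose_two_le_sum {V : Type*} [Fintype V] (f : V → ℕ)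
    (hle : ∀ A : Finset V, A.card.choose 2 ≤ ∑ v ∈ A, f v)
    (heq : ∑ v, f v = (Fintype.card V).choose 2) :
    ∃ G : Digraph V, IsTournament G ∧ ∀ v, score G v = f v := by
  classical
  obtain ⟨g, hg, hmem⟩ := (Finset.all_card_le_biUnion_card_iff_exists_injective
    (fun e : {e : Finset V // e.card = 2} =>
      e.1.sigma fun v => (Finset.univ : Finset (Fin (f v))))).1 (by
    intro E
    set U := E.biUnion Subtype.val with hU
    have h1 : E.card ≤ U.card.choose 2 := by
      rw [← Finset.card_powersetCard, ← Finset.card_map (Function.Embedding.subtype _)]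
      refine Finset.card_le_card fun e he => ?_
      obtain ⟨e, he', rfl⟩ := Finset.mem_map.1 he
      exact Finset.mem_powersetCard.2 ⟨Finset.subset_biUnion_of_mem Subtype.val he', e.2⟩
    refine (h1.trans (hle U)).trans ?_
    have h2 : ∑ v ∈ U, f v = (U.sigma fun v => (Finset.univ : Finset (Fin (f v)))).card := by
      simp
    rw [h2]
    refine Finset.card_le_card fun a ha => ?_
    simp only [Finset.mem_sigma, hU, Finset.mem_biUnion, Finset.mem_univ, and_true] at ha ⊢
    exact ha)
  have hmem' : ∀ v w (h : v ≠ w), (g ⟨{v, w}, Finset.card_pair h⟩).1 = v ∨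
      (g ⟨{v, w}, Finset.card_pair h⟩).1 = w := by
    intro v w h
    have := hmem ⟨{v, w}, Finset.card_pair h⟩
    simpa using this
  let G : Digraph V := ⟨fun v w => ∃ h : v ≠ w, (g ⟨{v, w}, Finset.card_pair h⟩).1 = v⟩
  have hG : IsTournament G := by
    refine ⟨fun v ⟨h, _⟩ => h rfl, fun v w h => ?_⟩
    have hvw := hmem' v w h
    have hswap : (⟨{w, v}, Finset.card_pair h.symm⟩ : {e : Finset V // e.card = 2}) =
        ⟨{v, w}, Finset.card_pair h⟩ := Subtype.ext (Finset.pair_comm w v)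
    constructor
    · rintro ⟨_, h1⟩ ⟨_, h2⟩
      rw [hswap] at h2
      exact h (h1.symm.trans h2)
    · intro h1
      refine ⟨h, hvw.resolve_right fun h2 => h1 ⟨h.symm, ?_⟩⟩
      rw [hswap]
      exact h2
  have hscore : ∀ v, score G v ≤ f v := by
    intro v
    have hcard : (({v} : Finset V).sigma fun v => (Finset.univ : Finset (Fin (f v)))).card = f v := by
      simp
    rw [← hcard]
    refine Finset.card_le_card_of_forall_subsingleton
      (fun w a => ∃ h : v ≠ w, g ⟨{v, w}, Finset.card_pair h⟩ = a) ?_ ?_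
    · intro w hw
      obtain ⟨h, h1⟩ : G.Adj v w := by simpa using hw
      exact ⟨_, Finset.mem_sigma.2 ⟨Finset.mem_singleton.2 h1, Finset.mem_univ _⟩, h, rfl⟩
    · rintro a - w ⟨-, h, hw⟩ w' ⟨-, h', hw'⟩
      have h1 := congrArg Subtype.val (hg (hw.trans hw'.symm))
      have h2 : w ∈ ({v, w'} : Finset V) := by
        rw [← show ({v, w} : Finset V) = {v, w'} from h1]
        simp
      simpa [h.symm] using h2
  refine ⟨G, hG, ?_⟩
  -- The scores are at most `f` and have the same total, so that all slots are used.
  have hsum : ∑ v, score G v = ∑ v, f v := by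
    rw [heq, (hG.sum_score_eq_choose_two_iff Finset.univ).2 (by simp), Finset.card_univ]
  have := (Finset.sum_eq_sum_iff_of_le fun v _ => hscore v).1 hsum
  exact fun v => this v (Finset.mem_univ v)

/-- A monotone function on `Fin n` has its smallest sum over a set of given size on the initial
segment of that size. -/
theorem sum_filter_val_lt_card_le {n : ℕ} {f : Fin n → ℕ} (hf : Monotone f) (A : Finset (Fin n)) :
    ∑ i with i.val < A.card, f i ≤ ∑ i ∈ A, f i := by
  classical
  rcases Nat.eq_zero_or_pos A.card with h0 | h0
  · simp [h0]
  have hAn : A.card ≤ n := by simpa using A.card_le_univ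
  set B : Finset (Fin n) := Finset.univ.filter fun i => i.val < A.card with hB
  have hcard : B.card = A.card := by
    rw [hB, Fin.card_filter_val_lt, min_eq_right hAn]
  -- The value `c` separates the values of `f` on `B` from those outside `B`.
  set c := f ⟨A.card - 1, by omega⟩
  rw [← Finset.sum_sdiff_le_sum_sdiff]
  have h1 : ∑ i ∈ B \ A, f i ≤ (B \ A).card * c := by
    rw [← smul_eq_mul]
    refine Finset.sum_le_card_nsmul _ _ _ fun i hi => hf ?_
    have := (Finset.mem_filter.1 (Finset.mem_sdiff.1 hi).1).2
    rw [Fin.le_def]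
    simp only
    omega
  have h2 : (A \ B).card * c ≤ ∑ i ∈ A \ B, f i := by
    rw [← smul_eq_mul]
    refine Finset.card_nsmul_le_sum _ _ _ fun i hi => hf ?_
    have := (Finset.mem_sdiff.1 hi).2
    rw [hB, Finset.mem_filter] at this
    rw [Fin.le_def]
    simp only [Finset.mem_univ, true_and] at this ⊢
    omega
  rw [Finset.card_sdiff_comm hcard] at h1
  exact h1.trans h2

/-- Landau's condition: `s` is nondecreasing, its prefixes of length `m` have sum at least
`m.choose 2`, and the whole of `s` attains this bound. -/
structure IsLandau (s : List ℕ) : Prop where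
  sorted : s.Pairwise (· ≤ ·)
  choose_le : ∀ m ≤ s.length, m.choose 2 ≤ (s.take m).sum
  sum_eq : s.sum = s.length.choose 2

theorem exists_perm_scoreSequence {n : ℕ} (G : Digraph (Fin n)) :
    ∃ σ : Equiv.Perm (Fin n), Monotone (score G ∘ σ) ∧
      scoreSequence G = List.ofFn (score G ∘ σ) := by
  refine ⟨Tuple.sort (score G), Tuple.monotone_sort _, ?_⟩
  refine List.Perm.eq_of_pairwise (le := (· ≤ ·)) (fun a b _ _ => le_antisymm)
    (Multiset.pairwise_sort _ _) (List.pairwise_ofFn.2 fun i j h => Tuple.monotone_sort _ h.le) ?_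
  rw [← Multiset.coe_eq_coe, scoreSequence, Multiset.sort_eq, ← Fin.univ_val_map,
    ← Multiset.map_map]
  congr 1
  exact (congrArg Finset.val (Finset.map_univ_equiv (Tuple.sort (score G)))).symm

theorem scoreSequence_eq_ofFn {n : ℕ} {G : Digraph (Fin n)} {f : Fin n → ℕ} (hf : Monotone f)
    (h : ∀ v, score G v = f v) : scoreSequence G = List.ofFn f := by
  obtain rfl : score G = f := funext h
  refine List.Perm.eq_of_pairwise (le := (· ≤ ·)) (fun a b _ _ => le_antisymm)
    (Multiset.pairwise_sort _ _) (List.pairwise_ofFn.2 fun i j h => hf h.le) ?_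
  rw [← Multiset.coe_eq_coe, scoreSequence, Multiset.sort_eq, ← Fin.univ_val_map]

theorem exists_sum_take_scoreSequence {n : ℕ} (G : Digraph (Fin n)) {m : ℕ} (hm : m ≤ n) :
    ∃ A : Finset (Fin n), A.card = m ∧ ((scoreSequence G).take m).sum = ∑ v ∈ A, score G v := by
  obtain ⟨σ, -, hs⟩ := exists_perm_scoreSequence G
  refine ⟨(Finset.univ.filter fun i : Fin n => i.val < m).map σ.toEmbedding, ?_, ?_⟩
  · rw [Finset.card_map, Fin.card_filter_val_lt, min_eq_right hm]
  · rw [hs, List.sum_take_ofFn, Finset.sum_map]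
    rfl

theorem sum_take_scoreSequence_le {n : ℕ} (G : Digraph (Fin n)) (A : Finset (Fin n)) :
    ((scoreSequence G).take A.card).sum ≤ ∑ v ∈ A, score G v := by
  obtain ⟨σ, hσ, hs⟩ := exists_perm_scoreSequence G
  have := sum_filter_val_lt_card_le hσ (A.map σ.symm.toEmbedding)
  rw [Finset.card_map, Finset.sum_map] at this
  rw [hs, List.sum_take_ofFn]
  simpa using this

theorem length_scoreSequence {n : ℕ} (G : Digraph (Fin n)) : (scoreSequence G).length = n := by
  simp [scoreSequence]

theorem sum_scoreSequence {n : ℕ} (G : Digraph (Fin n)) :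
    (scoreSequence G).sum = ∑ v, score G v := by
  rw [← Multiset.sum_coe, scoreSequence, Multiset.sort_eq]
  rfl

theorem IsTournament.isLandau {n : ℕ} {G : Digraph (Fin n)} (hG : IsTournament G) :
    IsLandau (scoreSequence G) where
  sorted := Multiset.pairwise_sort _ _
  choose_le m hm := by
    rw [length_scoreSequence] at hm
    obtain ⟨A, rfl, hA⟩ := exists_sum_take_scoreSequence G hm
    rw [hA]
    exact hG.choose_two_le_sum_score A
  sum_eq := by
    rw [sum_scoreSequence, length_scoreSequence,
      (hG.sum_score_eq_choose_two_iff Finset.univ).2 (by simp), Finset.card_univ, Fintype.card_fin]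

theorem IsLandau.exists_tournament {s : List ℕ} (hs : IsLandau s) :
    ∃ G : Digraph (Fin s.length), IsTournament G ∧ scoreSequence G = s := by
  have hmono : Monotone s.get := fun i j hij => by
    rcases hij.eq_or_lt with rfl | h
    · exact le_rfl
    · exact List.pairwise_iff_get.1 hs.sorted i j h
  obtain ⟨G, hG, h⟩ := exists_tournament_of_choose_two_le_sum s.get (fun A => by
      refine le_trans ?_ (sum_filter_val_lt_card_le hmono A)
      rw [← List.sum_take_ofFn, List.ofFn_get]
      exact hs.choose_le _ (by simpa using A.card_le_univ))
    (by rw [← List.sum_ofFn, List.ofFn_get, Fintype.card_fin, hs.sum_eq])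
  exact ⟨G, hG, by rw [scoreSequence_eq_ofFn hmono h, List.ofFn_get]⟩

/-- **Landau's theorem**. -/
theorem mem_S_iff {n : ℕ} {s : List ℕ} : s ∈ S n ↔ s.length = n ∧ IsLandau s := by
  classical
  constructor
  · intro h
    obtain ⟨G, hG, rfl⟩ := Finset.mem_image.1 h
    exact ⟨length_scoreSequence G, (Finset.mem_filter.1 hG).2.isLandau⟩
  · rintro ⟨rfl, hs⟩
    obtain ⟨G, hG, h⟩ := hs.exists_tournament
    exact Finset.mem_image.2 ⟨G, Finset.mem_filter.2 ⟨Finset.mem_univ _, hG⟩, h⟩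

/-- Strong score sequences are the nonempty ones whose proper nonempty prefixes satisfy Landau's
inequality strictly: a tight prefix corresponds to a set of vertices that no arrow leaves. -/
theorem isStrong_iff {s : List ℕ} : IsStrong s ↔
    IsLandau s ∧ s ≠ [] ∧ ∀ m, 0 < m → m < s.length → m.choose 2 < (s.take m).sum := by
  classical
  constructor
  · rintro ⟨n, G, hG, ⟨hne, hconn⟩, rfl⟩
    refine ⟨hG.isLandau, ?_, ?_⟩
    · rw [← List.length_pos_iff, length_scoreSequence]
      exact Fin.pos_iff_nonempty.2 hne
    · intro m h0 hm
      rw [length_scoreSequence] at hm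
      obtain ⟨A, rfl, hA⟩ := exists_sum_take_scoreSequence G hm.le
      rw [hA]
      refine lt_of_le_of_ne (hG.choose_two_le_sum_score A) fun h => ?_
      rw [eq_comm, hG.sum_score_eq_choose_two_iff] at h
      obtain ⟨v, hv⟩ := Finset.card_pos.1 h0
      have hall : ∀ w, w ∈ A := fun w => by
        have := hconn v w
        induction this with
        | refl => exact hv
        | tail _ h1 ih => exact h _ ih _ h1
      have : A = Finset.univ := Finset.eq_univ_iff_forall.2 hall
      simp [this] at hm
  · rintro ⟨hs, hne, hlt⟩
    obtain ⟨G, hG, h⟩ := hs.exists_tournament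
    refine ⟨s.length, G, hG, ⟨Fin.pos_iff_nonempty.1 (List.length_pos_iff.2 hne), ?_⟩, h⟩
    intro v w
    by_contra hvw
    -- The set of vertices reachable from `v` is left by no arrow.
    set A : Finset (Fin s.length) := Finset.univ.filter fun x => Relation.ReflTransGen G.Adj v x
      with hA
    have h1 := (hG.sum_score_eq_choose_two_iff A).2 (by
      intro x hx y hxy
      simp only [hA, Finset.mem_filter, Finset.mem_univ, true_and] at hx ⊢
      exact hx.tail hxy)
    have h2 := sum_take_scoreSequence_le G A
    have h3 := hlt A.card (Finset.card_pos.2 ⟨v, by simp [hA, Relation.ReflTransGen.refl]⟩) (by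
      have : A.card < (Finset.univ : Finset (Fin s.length)).card :=
        Finset.card_lt_card (Finset.ssubset_univ_iff.2 fun h => hvw (by
          have := h ▸ Finset.mem_univ w
          simpa [hA] using this))
      simpa using this)
    rw [h] at h2
    omega

/-! ### Direct sums and strong summands -/

theorem choose_two_add (a b : ℕ) : (a + b).choose 2 = a.choose 2 + b.choose 2 + b * a := by
  induction b with
  | zero => simp
  | succ b ih =>
    rw [← add_assoc, Nat.choose_succ_succ' (a + b), ih, Nat.choose_succ_succ' b]
    simp only [Nat.choose_one_right]
    ring

theorem sum_map_add_const (v : List ℕ) (c : ℕ) :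
    (v.map fun a => a + c).sum = v.sum + v.length * c := by
  rw [List.sum_map_add]
  simp

theorem length_directSum (u v : List ℕ) : (directSum u v).length = u.length + v.length := by
  simp [directSum]

theorem sum_directSum (u v : List ℕ) :
    (directSum u v).sum = u.sum + (v.sum + v.length * u.length) := by
  rw [directSum, List.sum_append, sum_map_add_const]

theorem take_directSum_of_le {u : List ℕ} (v : List ℕ) {m : ℕ} (hm : m ≤ u.length) :
    (directSum u v).take m = u.take m := by
  rw [directSum, List.take_append_of_le_length hm]

theorem take_directSum_add (u v : List ℕ) (m : ℕ) :
    (directSum u v).take (u.length + m) = directSum u (v.take m) := by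
  rw [directSum, directSum, List.take_length_add_append, List.map_take]

theorem directSum_assoc (u v w : List ℕ) :
    directSum (directSum u v) w = directSum u (directSum v w) := by
  simp only [directSum, List.map_append, List.map_map, List.append_assoc, List.length_append,
    List.length_map, Function.comp_def, add_assoc, add_comm u.length]

theorem directSum_nil (u : List ℕ) : directSum u [] = u := by simp [directSum]

theorem nil_directSum (u : List ℕ) : directSum [] u = u := by simp [directSum]

theorem directSum_inj {u v u' v' : List ℕ} (h : directSum u v = directSum u' v')
    (hl : u.length = u'.length) : u = u' ∧ v = v' := by
  obtain ⟨rfl, h2⟩ := List.append_inj h hl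
  exact ⟨rfl, List.map_injective_iff.2 (add_left_injective _) h2⟩

theorem directSums_append (a b : List (List ℕ)) :
    directSums (a ++ b) = directSum (directSums a) (directSums b) := by
  induction a with
  | nil => exact (nil_directSum _).symm
  | cons t a ih =>
    change directSum t (directSums (a ++ b)) = directSum (directSum t (directSums a)) _
    rw [ih, directSum_assoc]

theorem isLandau_nil : IsLandau [] := ⟨by simp, by simp, by simp⟩

/-- The largest letter is the difference of the sum of `u` and the sum of its longest proper prefix,
which is at most `u.length - 1`. -/
theorem IsLandau.lt_length {u : List ℕ} (hu : IsLandau u) {a : ℕ} (ha : a ∈ u) :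
    a < u.length := by
  rcases List.eq_nil_or_concat u with rfl | ⟨w, b, rfl⟩
  · simp at ha
  rw [List.concat_eq_append] at *
  have h1 := hu.choose_le w.length (by simp)
  have h2 := hu.sum_eq
  have h3 := (List.pairwise_append.1 hu.sorted).2.2
  simp only [List.take_left', List.sum_append, List.length_append, List.sum_cons, List.sum_nil,
    List.length_cons, List.length_nil, choose_two_add] at h1 h2 ⊢
  have h4 : a ≤ b := by
    rcases List.mem_append.1 ha with h | h
    · exact h3 a h b (by simp)
    · exact (List.mem_singleton.1 h).le
  simp at h2
  omega

theorem IsLandau.directSum {u v : List ℕ} (hu : IsLandau u) (hv : IsLandau v) :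
    IsLandau (directSum u v) where
  sorted := by
    refine List.pairwise_append.2 ⟨hu.sorted, ?_, ?_⟩
    · exact hv.sorted.map _ fun a b h => Nat.add_le_add_right h _
    · intro a ha b hb
      obtain ⟨c, -, rfl⟩ := List.mem_map.1 hb
      exact (hu.lt_length ha).le.trans (Nat.le_add_left _ _)
  choose_le m hm := by
    rcases le_total m u.length with h | h
    · rw [take_directSum_of_le v h]
      exact hu.choose_le m h
    · obtain ⟨m, rfl⟩ := Nat.exists_eq_add_of_le h
      rw [length_directSum] at hm
      have := hv.choose_le m (by omega)
      rw [take_directSum_add, sum_directSum, hu.sum_eq, choose_two_add,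
        List.length_take_of_le (by omega)]
      omega
  sum_eq := by
    rw [length_directSum, sum_directSum, hu.sum_eq, hv.sum_eq, choose_two_add, add_assoc]

/-- A tight prefix splits off as a direct summand. -/
theorem IsLandau.exists_directSum {s : List ℕ} (hs : IsLandau s) {m : ℕ} (hm : m ≤ s.length)
    (htight : (s.take m).sum = m.choose 2) :
    ∃ v, IsLandau (s.take m) ∧ IsLandau v ∧ s = ScoreSeq.directSum (s.take m) v := by
  have hlen : (s.take m).length = m := List.length_take_of_le hm
  have hge : ∀ a ∈ s.drop m, m ≤ a := by
    intro a ha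
    have hlt : m < s.length := by
      by_contra h
      rw [List.drop_of_length_le (by omega)] at ha
      simp at ha
    have h1 := hs.choose_le (m + 1) hlt
    have h2 := hs.sorted.sublist (List.drop_sublist m s)
    rw [List.drop_eq_getElem_cons hlt] at ha h2
    rw [← List.take_append_getElem hlt, List.sum_append, htight, choose_two_add] at h1
    have h3 : s[m] ≤ a := by
      rcases List.mem_cons.1 ha with h | h
      · exact h.ge
      · exact (List.pairwise_cons.1 h2).1 a h
    simp at h1
    omega
  have hsplit : s = ScoreSeq.directSum (s.take m) ((s.drop m).map fun a => a - m) := by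
    conv_lhs => rw [← List.take_append_drop m s]
    rw [ScoreSeq.directSum, hlen, List.map_map]
    congr 1
    conv_lhs => rw [← List.map_id (s.drop m)]
    refine List.map_congr_left fun a ha => ?_
    have := hge a ha
    simp only [id, Function.comp]
    omega
  refine ⟨_, ⟨hs.sorted.sublist (List.take_sublist m s), ?_, by rw [htight, hlen]⟩,
    ⟨?_, ?_, ?_⟩, hsplit⟩
  · intro l hl
    rw [hlen] at hl
    rw [List.take_take, min_eq_left hl]
    exact hs.choose_le l (hl.trans hm)
  · exact (hs.sorted.sublist (List.drop_sublist m s)).map _ fun a b h => Nat.sub_le_sub_right h _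
  · intro l hl
    have h1 := hs.choose_le (m + l) (by simp at hl; omega)
    rw [hsplit] at h1
    have h2 := take_directSum_add (s.take m) ((s.drop m).map fun a => a - m) l
    rw [hlen] at h2
    rw [h2, sum_directSum, htight, hlen, choose_two_add, List.length_take_of_le hl] at h1
    omega
  · have h1 := hs.sum_eq
    rw [hsplit] at h1
    rw [length_directSum, sum_directSum, htight, hlen, choose_two_add] at h1
    omega

theorem IsStrong.isLandau {t : List ℕ} (ht : IsStrong t) : IsLandau t := (isStrong_iff.1 ht).1

theorem isLandau_directSums {ts : List (List ℕ)} (h : ∀ t ∈ ts, IsStrong t) :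
    IsLandau (directSums ts) := by
  induction ts with
  | nil => exact isLandau_nil
  | cons t ts ih =>
    exact (h t (by simp)).isLandau.directSum (ih fun t' ht' => h t' (by simp [ht']))

/-- The first strong summand is the shortest nonempty tight prefix. -/
theorem IsLandau.exists_isStrongDecomposition {s : List ℕ} (hs : IsLandau s) :
    ∃ ts, IsStrongDecomposition s ts := by
  induction hn : s.length using Nat.strong_induction_on generalizing s with
  | _ n ih =>
  subst hn
  rcases eq_or_ne s [] with rfl | hne
  · exact ⟨[], by simp, rfl⟩
  have hpos := List.length_pos_iff.2 hne
  have hex : ∃ m, 0 < m ∧ m ≤ s.length ∧ (s.take m).sum = m.choose 2 :=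
    ⟨s.length, hpos, le_rfl, by rw [List.take_length, hs.sum_eq]⟩
  classical
  obtain ⟨h0, hm, htight⟩ := Nat.find_spec hex
  have hmin := fun l => Nat.find_min hex (m := l)
  set m := Nat.find hex
  obtain ⟨v, hu, hv, hsplit⟩ := hs.exists_directSum hm htight
  have hlen : (s.take m).length = m := List.length_take_of_le hm
  have hlens := congrArg List.length hsplit
  rw [length_directSum, hlen] at hlens
  obtain ⟨ts, hts, rfl⟩ := ih v.length (by omega) hv rfl
  refine ⟨s.take m :: ts, ?_, hsplit.symm⟩
  refine List.forall_mem_cons.2 ⟨isStrong_iff.2 ⟨hu, ?_, ?_⟩, hts⟩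
  · rw [← List.length_pos_iff, hlen]
    exact h0
  · intro l hl0 hl
    rw [hlen] at hl
    rw [List.take_take, min_eq_left hl.le]
    exact lt_of_le_of_ne (hs.choose_le l (by omega)) fun h => hmin l hl ⟨hl0, by omega, h.symm⟩

/-- The pair `(u, i)` is a pointed score sequence whose position `i` lies in the last strong summand
of `u`: no proper prefix longer than `i` is tight. -/
structure PointsToLast (u : List ℕ) (i : ℕ) : Prop where
  isLandau : IsLandau u
  lt_length : i < u.length
  choose_lt : ∀ m, i < m → m < u.length → m.choose 2 < (u.take m).sum

theorem IsStrong.pointsToLast {t : List ℕ} (ht : IsStrong t) : PointsToLast t 0 := by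
  obtain ⟨h1, h2, h3⟩ := isStrong_iff.1 ht
  exact ⟨h1, List.length_pos_iff.2 h2, h3⟩

theorem PointsToLast.length_le {u u' v v' : List ℕ} {i : ℕ} (hu : PointsToLast u i)
    (hu' : PointsToLast u' i) (h : directSum u v = directSum u' v') : u.length ≤ u'.length := by
  by_contra! hlt
  have h1 := hu.choose_lt _ hu'.lt_length hlt
  rw [← take_directSum_of_le v hlt.le, h, take_directSum_of_le v' le_rfl, List.take_length,
    hu'.isLandau.sum_eq] at h1
  exact h1.false

/-- A left direct summand `u` for which `i` lies in the last strong summand is determined by the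
sum and by `i`. -/
theorem PointsToLast.directSum_inj {u u' v v' : List ℕ} {i : ℕ} (hu : PointsToLast u i)
    (hu' : PointsToLast u' i) (h : directSum u v = directSum u' v') : u = u' ∧ v = v' :=
  ScoreSeq.directSum_inj h ((hu.length_le hu' h).antisymm (hu'.length_le hu h.symm))

theorem IsStrongDecomposition.unique {s : List ℕ} {ts ts' : List (List ℕ)}
    (h : IsStrongDecomposition s ts) (h' : IsStrongDecomposition s ts') : ts = ts' := by
  obtain ⟨h1, h2⟩ := h
  obtain ⟨h1', h2'⟩ := h'
  rw [← h2] at h2'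
  clear h2
  have hnil : ∀ (t : List ℕ) (us : List (List ℕ)), IsStrong t →
      directSums (t :: us) ≠ [] := fun t us ht h => by
    have := congrArg List.length h
    have h0 := ht.pointsToLast.lt_length
    change (directSum t (directSums us)).length = 0 at this
    rw [length_directSum] at this
    omega
  induction ts generalizing ts' with
  | nil =>
    cases ts' with
    | nil => rfl
    | cons t' ts' => exact absurd h2' (hnil t' ts' (h1' t' (by simp)))
  | cons t ts ih =>
    cases ts' with
    | nil => exact absurd h2'.symm (hnil t ts (h1 t (by simp)))
    | cons t' ts' =>
      obtain ⟨ht, hts⟩ := List.forall_mem_cons.1 h1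
      obtain ⟨ht', hts'⟩ := List.forall_mem_cons.1 h1'
      obtain ⟨rfl, h3⟩ := ht'.pointsToLast.directSum_inj ht.pointsToLast h2'
      rw [ih hts hts' h3]

theorem IsLandau.existsUnique_isStrongDecomposition {s : List ℕ} (hs : IsLandau s) :
    ∃! ts, IsStrongDecomposition s ts := by
  obtain ⟨ts, hts⟩ := hs.exists_isStrongDecomposition
  exact ⟨ts, hts, fun ts' hts' => hts'.unique hts⟩

theorem PointsToLast.directSum_left {u' t : List ℕ} {i : ℕ} (hu' : IsLandau u')
    (ht : PointsToLast t 0) (hi : u'.length ≤ i) (hi' : i < (directSum u' t).length) :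
    PointsToLast (directSum u' t) i := by
  refine ⟨hu'.directSum ht.isLandau, hi', fun m hm hm' => ?_⟩
  obtain ⟨m, rfl⟩ := Nat.exists_eq_add_of_le (hi.trans hm.le)
  rw [length_directSum] at hm'
  have := ht.choose_lt m (by omega) (by omega)
  rw [take_directSum_add, sum_directSum, hu'.sum_eq, choose_two_add,
    List.length_take_of_le (by omega)]
  omega

/-- Together with `PointsToLast.directSum_inj`, this characterizes the two parts of `s` without
reference to the cut index. -/
theorem IsLandau.leftPart_rightPart_spec {s : List ℕ} (hs : IsLandau s) {i : ℕ}
    (hi : i < s.length) : PointsToLast (leftPart s i) i ∧ IsLandau (rightPart s i) ∧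
      ScoreSeq.directSum (leftPart s i) (rightPart s i) = s := by
  have hts : IsStrongDecomposition s (strongSummands s) :=
    Classical.epsilon_spec hs.exists_isStrongDecomposition
  have hmem : i < (directSums ((strongSummands s).take (cutIndex s i))).length :=
    Nat.sInf_mem (s := {j : ℕ | i < (directSums ((strongSummands s).take j)).length})
      ⟨(strongSummands s).length, by
        rw [Set.mem_ofPred_eq, List.take_length, hts.2]
        exact hi⟩
  have hmin : ∀ j < cutIndex s i, (directSums ((strongSummands s).take j)).length ≤ i :=
    fun j hj => not_lt.1 fun h => Nat.notMem_of_lt_sInf (m := j) hj h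
  unfold leftPart rightPart
  set ts := strongSummands s
  set j := cutIndex s i
  refine ⟨?_, isLandau_directSums fun t ht => hts.1 t (List.mem_of_mem_drop ht), ?_⟩
  · rcases hj : j with _ | j'
    · rw [hj] at hmem
      simp [directSums] at hmem
    · rw [hj] at hmem
      have h1 := hmin j' (by omega)
      have hlt : j' < ts.length := by
        by_contra hge
        rw [List.take_of_length_le (by omega)] at h1 hmem
        omega
      rw [← List.take_append_getElem hlt, directSums_append] at hmem ⊢
      have h2 : directSums [ts[j']] = ts[j'] := directSum_nil _
      rw [h2] at hmem ⊢
      exact PointsToLast.directSum_left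
        (isLandau_directSums fun t ht => hts.1 t (List.mem_of_mem_take ht))
        (hts.1 _ (List.getElem_mem hlt)).pointsToLast h1 hmem
  · rw [← directSums_append, List.take_append_drop, hts.2]

theorem PointsToLast.leftPart_eq_and_rightPart_eq {u v : List ℕ} {i : ℕ} (hu : PointsToLast u i)
    (hv : IsLandau v) : leftPart (directSum u v) i = u ∧ rightPart (directSum u v) i = v := by
  obtain ⟨h1, -, h2⟩ := (hu.isLandau.directSum hv).leftPart_rightPart_spec
    (i := i) (by rw [length_directSum]; exact Nat.lt_add_right _ hu.lt_length)
  exact h1.directSum_inj hu h2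

/-! ### The cycle lemma -/

/-- The multiset of the residues of `u₀ - i, u₁ - i, …` modulo `k`. This is `mu u i` with a modulus
that need not be syntactically the length of `u`. -/
def residues (k : ℕ) (u : List ℕ) (i : ℕ) : Multiset (ZMod k) :=
  (u : Multiset ℕ).map fun a : ℕ => (a : ZMod k) - (i : ZMod k)

/-- In `mu` the letters are cast by a monadic lift of the whole list, which is the same as casting
them one by one. -/
theorem mu_eq_residues (u : List ℕ) (i : ℕ) : mu u i = residues u.length u i := by
  simp [mu, residues, ← List.map_eq_flatMap, Function.comp_def]

theorem perm_map_mod_of_residues_eq {k d i : ℕ} [NeZero k] {u u' : List ℕ}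
    (hu' : ∀ a ∈ u', a < k) (h : residues k u i = residues k u' (i + d)) :
    u'.Perm (u.map fun a => (a + d) % k) := by
  have h1 := congrArg (Multiset.map fun x : ZMod k => (x + ((i + d : ℕ) : ZMod k)).val) h
  simp only [residues, Multiset.map_coe, List.map_map, Function.comp_def, sub_add_cancel] at h1
  rw [Multiset.coe_eq_coe] at h1
  have h2 : u'.map (fun a => ((a : ℕ) : ZMod k).val) = u' := by
    conv_rhs => rw [← List.map_id u']
    exact List.map_congr_left fun a ha => ZMod.val_cast_of_lt (hu' a ha)
  have h3 : (fun a : ℕ => ((a : ZMod k) - (i : ZMod k) + ((i + d : ℕ) : ZMod k)).val) =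
      fun a => (a + d) % k := by
    funext a
    rw [← ZMod.val_natCast]
    congr 1
    push_cast
    ring
  rw [h2, h3] at h1
  exact h1.symm

theorem eq_filter_append_filter {u : List ℕ} (hu : u.Pairwise (· ≤ ·)) (c : ℕ) :
    u = u.filter (fun a => a < c) ++ u.filter (fun a => !decide (a < c)) := by
  refine List.Perm.eq_of_pairwise (le := (· ≤ ·)) (fun a b _ _ => le_antisymm) hu ?_
    (List.filter_append_perm _ u).symm
  refine List.pairwise_append.2 ⟨hu.filter _, hu.filter _, fun a ha b hb => ?_⟩
  simp at ha hb
  omega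

/-- The uniqueness half of the cycle lemma, for indices in a given order. Here `u = lo ++ hi`, where
`hi` consists of the letters that exceed the range when `d` is added, and `u'` is `hi` lowered by
`k - d` followed by `lo` raised by `d`. -/
theorem PointsToLast.eq_of_residues_eq_add {k i d : ℕ} {u u' : List ℕ} (hu : PointsToLast u i)
    (hu' : PointsToLast u' (i + d)) (hk : u.length = k) (hk' : u'.length = k)
    (h : residues k u i = residues k u' (i + d)) : u = u' ∧ d = 0 := by
  have hi' := hu'.lt_length
  rw [hk'] at hi'
  have : NeZero k := ⟨by omega⟩
  have hperm := perm_map_mod_of_residues_eq (fun a ha => hk' ▸ hu'.isLandau.lt_length ha) h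
  have hltk : ∀ a ∈ u, a < k := fun a ha => hk ▸ hu.isLandau.lt_length ha
  have hsplit := eq_filter_append_filter hu.isLandau.sorted (k - d)
  have hlo : ∀ a ∈ u.filter (fun a => a < k - d), a < k - d := fun a ha => by
    simpa using (List.mem_filter.1 ha).2
  have hhi : ∀ a ∈ u.filter (fun a => !decide (a < k - d)), k - d ≤ a ∧ a < k := fun a ha => by
    have h1 := List.mem_filter.1 ha
    exact ⟨by simpa using h1.2, hltk a h1.1⟩
  generalize u.filter (fun a => a < k - d) = lo at hsplit hlo
  generalize u.filter (fun a => !decide (a < k - d)) = hi at hsplit hhi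
  subst hsplit
  have hlosort := (List.pairwise_append.1 hu.isLandau.sorted).1
  have hhisort := (List.pairwise_append.1 hu.isLandau.sorted).2.1
  have hu'eq : u' = hi.map (fun a => a - (k - d)) ++ lo.map (fun a => a + d) := by
    refine List.Perm.eq_of_pairwise (le := (· ≤ ·)) (fun a b _ _ => le_antisymm)
      hu'.isLandau.sorted ?_ ?_
    · refine List.pairwise_append.2 ⟨hhisort.map _ fun a b hab => Nat.sub_le_sub_right hab _,
        hlosort.map _ fun a b hab => Nat.add_le_add_right hab _, fun a ha b hb => ?_⟩
      obtain ⟨a, ha', rfl⟩ := List.mem_map.1 ha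
      obtain ⟨b, hb', rfl⟩ := List.mem_map.1 hb
      have := hhi a ha'
      omega
    · refine hperm.trans ?_
      rw [List.map_append]
      refine List.perm_append_comm.trans ?_
      have e1 : hi.map (fun a => (a + d) % k) = hi.map (fun a => a - (k - d)) :=
        List.map_congr_left fun a ha => by
          have := hhi a ha
          rw [Nat.mod_eq_sub_mod (by omega), Nat.mod_eq_of_lt (by omega)]
          omega
      have e2 : lo.map (fun a => (a + d) % k) = lo.map (fun a => a + d) :=
        List.map_congr_left fun a ha => by
          have := hlo a ha
          rw [Nat.mod_eq_of_lt (by omega)]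
      rw [e1, e2]
  have hhisum : (hi.map fun a => a - (k - d)).sum + hi.length * (k - d) = hi.sum := by
    rw [← List.length_map (fun a => a - (k - d)), ← sum_map_add_const, List.map_map]
    congr 1
    conv_rhs => rw [← List.map_id hi]
    exact List.map_congr_left fun a ha => Nat.sub_add_cancel (hhi a ha).1
  have hs := hu.isLandau.sum_eq
  have hs' := hu'.isLandau.sum_eq
  have hpre := hu.choose_lt lo.length
  have hpre' := hu'.isLandau.choose_le hi.length
  rw [hk', hu'eq] at hpre'
  rw [hk', hu'eq, List.sum_append, sum_map_add_const] at hs'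
  rw [hk, List.sum_append] at hs
  rw [List.take_left', List.length_append] at hpre
  rotate_left
  · rfl
  rw [List.take_left' (by simp)] at hpre'
  rw [List.length_append] at hk
  -- Both `u` and `u'` have sum `k.choose 2`, so exactly `d` letters wrap around.
  have hd : hi.length = d := by
    have e : lo.length * d = hi.length * (k - d) := by omega
    have e2 : k * d = k * hi.length := by
      zify [show d ≤ k by omega] at e hk ⊢
      rw [← hk] at e ⊢
      linear_combination e
    exact (Nat.eq_of_mul_eq_mul_left (by omega) e2).symm
  rcases Nat.eq_zero_or_pos d with rfl | hd0
  · refine ⟨?_, rfl⟩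
    obtain rfl := List.length_eq_zero_iff.1 hd
    simpa using hu'eq.symm
  · exfalso
    -- Since `i < k - d`, the prefix `lo` is not tight. But then the prefix of `u'` made from `hi`
    -- is below Landau's bound.
    have h1 := hpre (by omega) (by omega)
    have h2 := hpre' (by omega)
    have h3 : k.choose 2 = hi.length.choose 2 + lo.length.choose 2 + lo.length * d := by
      rw [← hd, ← choose_two_add, ← hk, add_comm]
    omega

theorem PointsToLast.eq_of_residues_eq {k i i' : ℕ} {u u' : List ℕ} (hu : PointsToLast u i)
    (hu' : PointsToLast u' i') (hk : u.length = k) (hk' : u'.length = k)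
    (h : residues k u i = residues k u' i') : u = u' ∧ i = i' := by
  rcases le_total i i' with hii | hii
  · obtain ⟨d, rfl⟩ := Nat.exists_eq_add_of_le hii
    obtain ⟨h1, rfl⟩ := hu.eq_of_residues_eq_add hu' hk hk' h
    exact ⟨h1, rfl⟩
  · obtain ⟨d, rfl⟩ := Nat.exists_eq_add_of_le hii
    obtain ⟨h1, rfl⟩ := hu'.eq_of_residues_eq_add hu hk' hk h.symm
    exact ⟨h1.symm, rfl⟩

/-- In any window of one period, there is a first global minimum of a periodic function. -/
theorem exists_first_argmin_of_periodic {f : ℕ → ℤ} {k : ℕ} (hk : 0 < k)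
    (hf : Function.Periodic f k) (B : ℕ) :
    ∃ m, B ≤ m ∧ m < B + k ∧ (∀ l, f m ≤ f l) ∧ ∀ l, B ≤ l → l < m → f m < f l := by
  classical
  obtain ⟨m₀, -, h₀⟩ := Finset.exists_min_image (Finset.range k) f ⟨0, by simpa using hk⟩
  have hglob : ∀ l, f m₀ ≤ f l := fun l => by
    rw [← hf.map_mod_nat l]
    exact h₀ _ (by simpa using Nat.mod_lt l hk)
  have hex : ∃ m, B ≤ m ∧ ∀ l, f m ≤ f l := by
    refine ⟨m₀ + B * k, (Nat.le_mul_of_pos_right B hk).trans (Nat.le_add_left _ _), fun l => ?_⟩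
    have : f (m₀ + B * k) = f m₀ := by simpa using hf.nat_mul B m₀
    rw [this]
    exact hglob l
  obtain ⟨h1, h2⟩ := Nat.find_spec hex
  have hmin := fun l => Nat.find_min hex (m := l)
  set m := Nat.find hex
  refine ⟨m, h1, ?_, h2, fun l hl hlm => ?_⟩
  · by_contra! hge
    refine hmin (m - k) (by omega) ⟨by omega, fun l => ?_⟩
    have : f (m - k + k) = f (m - k) := hf (m - k)
    rw [← this, Nat.sub_add_cancel (by omega)]
    exact h2 l
  · refine lt_of_le_of_ne (h2 l) fun h => hmin l hlm ⟨hl, fun l' => ?_⟩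
    rw [← h]
    exact h2 l'

/-- The periodic extension of the sorted representatives of `M`: every window of length `k` has
residues `M`. -/
theorem exists_monotone_residues {k : ℕ} (hk : 0 < k) {M : Multiset (ZMod k)} (hM : M.card = k) :
    ∃ w : ℕ → ℕ, Monotone w ∧ (∀ j, w (j + k) = w j + k) ∧
      ∀ m, (Multiset.range k).map (fun j => (w (m + j) : ZMod k)) = M := by
  have : NeZero k := ⟨hk.ne'⟩
  set u := (M.map ZMod.val).sort (· ≤ ·) with hu
  have hlen : u.length = k := by simp [hu, hM]
  have hcoe : (u : Multiset ℕ) = M.map ZMod.val := Multiset.sort_eq _ _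
  have hsort : u.Pairwise (· ≤ ·) := Multiset.pairwise_sort _ _
  have hlt : ∀ j, u.getD j 0 < k := by
    intro j
    rcases lt_or_ge j u.length with h | h
    · rw [List.getD_eq_getElem _ _ h]
      have : u[j] ∈ (u : Multiset ℕ) := List.getElem_mem h
      rw [hcoe] at this
      obtain ⟨x, -, hx⟩ := Multiset.mem_map.1 this
      rw [← hx]
      exact ZMod.val_lt x
    · rw [List.getD_eq_default _ _ h]
      exact hk
  refine ⟨fun j => u.getD (j % k) 0 + k * (j / k), ?_, ?_, ?_⟩
  · refine monotone_nat_of_le_succ fun j => ?_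
    have hjk := Nat.mod_lt j hk
    rcases Nat.lt_or_ge (j % k + 1) k with h | h
    · have e1 : (j + 1) % k = j % k + 1 := by
        rw [← Nat.mod_add_mod, Nat.mod_eq_of_lt h]
      have e2 : (j + 1) / k = j / k := by
        rw [Nat.succ_div_of_not_dvd]
        intro hd
        have := Nat.mod_eq_zero_of_dvd hd
        omega
      simp only [e1, e2]
      refine Nat.add_le_add_right ?_ _
      rw [List.getD_eq_getElem _ _ (by omega), List.getD_eq_getElem _ _ (by omega)]
      exact List.pairwise_iff_getElem.1 hsort _ _ _ _ (Nat.lt_succ_self _)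
    · have e1 : (j + 1) % k = 0 := by
        rw [← Nat.mod_add_mod, show j % k + 1 = k by omega, Nat.mod_self]
      have e2 : (j + 1) / k = j / k + 1 := Nat.succ_div_of_dvd (Nat.dvd_of_mod_eq_zero e1)
      simp only [e1, e2, Nat.mul_succ]
      have := hlt (j % k)
      omega
  · intro j
    simp only [Nat.add_mod_right, Nat.add_div_right _ hk, Nat.mul_succ, add_assoc]
  · intro m
    have h1 : (Multiset.range k).map (fun j => (m + j) % k) = Multiset.range k := by
      have h2 : Multiset.Ico m (m + k) = (Multiset.range k).map (m + ·) := by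
        change ((List.range' m (m + k - m) : List ℕ) : Multiset ℕ) = _
        rw [Nat.add_sub_cancel_left, List.range'_eq_map_range]
        rfl
      conv_rhs => rw [← Nat.multiset_Ico_map_mod m k, h2, Multiset.map_map]
      rfl
    have h3 : (Multiset.range k).map (fun j => u.getD j 0) = M.map ZMod.val := by
      rw [← hcoe]
      refine congrArg _ (List.ext_getElem (by simp [hlen]) fun j _ hj => ?_)
      simp [hj]
    have h4 := congrArg (Multiset.map fun j => ((u.getD j 0 : ℕ) : ZMod k)) h1
    rw [Multiset.map_map] at h4
    have h5 := congrArg (Multiset.map fun a : ℕ => (a : ZMod k)) h3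
    rw [Multiset.map_map, Multiset.map_map] at h5
    simp only [Function.comp_def, ZMod.natCast_val, ZMod.cast_id', id, Multiset.map_id'] at h4 h5
    simp only [Nat.cast_add, Nat.cast_mul, ZMod.natCast_self, zero_mul, add_zero]
    rw [h4, h5]

/-- The existence half of the cycle lemma. -/
theorem exists_pointsToLast_residues_eq {k : ℕ} (hk : 0 < k) {M : Multiset (ZMod k)}
    (hM : M.card = k) (hsum : M.sum = (k.choose 2 : ZMod k)) :
    ∃ u i, PointsToLast u i ∧ u.length = k ∧ residues k u i = M := by
  obtain ⟨w, hw, hwk, hres⟩ := exists_monotone_residues hk hM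
  obtain ⟨e, he⟩ : ∃ e : ℤ, ((∑ j ∈ Finset.range k, w j : ℕ) : ℤ) = k.choose 2 + k * e := by
    have h0 : ((∑ j ∈ Finset.range k, w j : ℕ) : ZMod k) = (k.choose 2 : ZMod k) := by
      rw [← hsum, ← hres 0, Nat.cast_sum]
      simp only [zero_add]
      rfl
    have h1 : ((k.choose 2 : ℕ) : ℤ) ≡ ((∑ j ∈ Finset.range k, w j : ℕ) : ℤ) [ZMOD k] := by
      rw [← ZMod.intCast_eq_intCast_iff, Int.cast_natCast, Int.cast_natCast, h0]
    obtain ⟨e, he⟩ := h1.dvd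
    exact ⟨e, by linarith⟩
  have hchoose : ∀ l, (((l + 1).choose 2 : ℕ) : ℤ) = (l.choose 2 : ℕ) + (l : ℕ) := fun l => by
    rw [choose_two_add]
    simp
  let f : ℕ → ℤ := fun m => ∑ j ∈ Finset.range m, ((w j : ℤ) - j - e)
  have hfs : ∀ m, f (m + 1) = f m + ((w m : ℤ) - m - e) := fun m => Finset.sum_range_succ _ _
  have hfe : ∀ m, f m = ((∑ j ∈ Finset.range m, w j : ℕ) : ℤ) - m.choose 2 - m * e := by
    intro m
    induction m with
    | zero => simp [f]
    | succ m ih =>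
      rw [hfs, ih, Finset.sum_range_succ, hchoose]
      push_cast
      ring
  have hper : Function.Periodic f k := by
    intro m
    induction m with
    | zero =>
      rw [zero_add, hfe k, he]
      simp [f]
    | succ m ih =>
      rw [add_right_comm, hfs, hfs, ih, hwk]
      push_cast
      ring
  -- The window of starting points begins at `1 - e` modulo `k`. The multiple of `k` that is added
  -- keeps it in `ℕ`.
  obtain ⟨B, hB⟩ : ∃ B : ℕ, (B : ℤ) = e.natAbs * k + 1 - e := by
    refine ⟨(e.natAbs * k + 1 - e).toNat, Int.toNat_of_nonneg ?_⟩
    have h1 : (1 : ℤ) ≤ k := by exact_mod_cast hk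
    have h2 : e ≤ e.natAbs := Int.le_natAbs
    nlinarith
  obtain ⟨m, hBm, hmB, hmin, hfirst⟩ := exists_first_argmin_of_periodic hk hper B
  -- The minimality of `f m` bounds the first letter of the sequence below by `0`.
  have hnn : ∀ j, (0 : ℤ) ≤ (w (m + j) : ℤ) - m - e := fun j => by
    have h1 := hmin (m + 1)
    rw [hfs] at h1
    have h2 : (w m : ℤ) ≤ w (m + j) := by exact_mod_cast hw (Nat.le_add_right m j)
    linarith
  let g : ℕ → ℕ := fun j => ((w (m + j) : ℤ) - m - e).toNat
  have hg : ∀ j, (g j : ℤ) = (w (m + j) : ℤ) - m - e := fun j => Int.toNat_of_nonneg (hnn j)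
  have hgmono : Monotone g := fun a b hab => by
    have h1 : (w (m + a) : ℤ) ≤ w (m + b) := by exact_mod_cast hw (Nat.add_le_add_left hab m)
    have := hg a
    have := hg b
    omega
  have hsumg : ∀ l, (((List.range l).map g).sum : ℤ) = f (m + l) - f m + l.choose 2 := by
    intro l
    induction l with
    | zero => simp
    | succ l ih =>
      rw [List.sum_range_succ, Nat.cast_add, ih, hg, ← add_assoc, hfs, hchoose]
      push_cast
      ring
  have htake : ∀ l ≤ k, ((List.range k).map g).take l = (List.range l).map g := fun l hl => by
    rw [← List.map_take, List.take_range, min_eq_left hl]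
  -- The index satisfies `i ≡ -m - e` modulo `k`, and `0 ≤ i < k` as `B ≤ m < B + k`.
  refine ⟨(List.range k).map g, B + k - 1 - m, ⟨⟨?_, ?_, ?_⟩, ?_, ?_⟩, by simp, ?_⟩
  · exact (List.pairwise_le_range).map g fun a b h => hgmono h
  · intro l hl
    rw [List.length_map, List.length_range] at hl
    rw [htake l hl]
    have := hsumg l
    have := hmin (m + l)
    omega
  · have := hsumg k
    rw [hper m] at this
    simp only [List.length_map, List.length_range]
    omega
  · simp only [List.length_map, List.length_range]
    omega
  · intro l hl hl'
    rw [List.length_map, List.length_range] at hl'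
    rw [htake l hl'.le]
    have h1 := hsumg l
    -- The positions `m + l` with `i < l` are, one period earlier, those of the window before `m`.
    have h2 := hfirst (m + l - k) (by omega) (by omega)
    rw [← hper (m + l - k), Nat.sub_add_cancel (by omega)] at h2
    omega
  · rw [← hres m, residues, Multiset.map_coe, List.map_map]
    change Multiset.map _ (Multiset.range k) = _
    refine Multiset.map_congr rfl fun j _ => ?_
    have h1 : ((g j : ℤ) : ZMod k) = (((w (m + j) : ℤ) - m - e : ℤ) : ZMod k) := by rw [hg]
    have h2 : ((B + k - 1 - m : ℕ) : ℤ) = (e.natAbs + 1) * k - e - m := by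
      rw [Nat.cast_sub (by omega), Nat.cast_sub (by omega)]
      push_cast
      rw [hB]
      push_cast
      ring
    have h3 := congrArg (Int.cast : ℤ → ZMod k) h2
    push_cast at h1 h3
    simp only [Function.comp]
    rw [h1, h3]
    simp
    ring

/-! ### The bijection and the generating function -/

theorem card_residues (k : ℕ) (u : List ℕ) (i : ℕ) : (residues k u i).card = u.length := by
  simp [residues]

theorem sum_residues (k : ℕ) (u : List ℕ) (i : ℕ) :
    (residues k u i).sum = (u.sum : ZMod k) - u.length * i := by
  rw [residues, Multiset.sum_map_sub, ← Nat.cast_multiset_sum]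
  simp

theorem count_zero_residues {k i : ℕ} {u : List ℕ} (hu : ∀ a ∈ u, a < k) (hi : i < k) :
    (residues k u i).count 0 = u.count i := by
  rw [residues, Multiset.count_map, ← Multiset.coe_count, ← Multiset.countP_eq_card_filter,
    Multiset.count]
  refine Multiset.countP_congr rfl fun a ha => ?_
  rw [eq_comm (a := (0 : ZMod k)), sub_eq_zero, ZMod.natCast_eq_natCast_iff', Nat.mod_eq_of_lt (hu a ha),
    Nat.mod_eq_of_lt hi]
  exact propext eq_comm

/-- Equality in the sigma type, with the equality of multisets taken in `ZMod k`. -/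
theorem Phi_eq_iff {s v : List ℕ} {i k : ℕ} {M : Multiset (ZMod k)} :
    Phi (s, i) = ⟨k, M, v⟩ ↔
      (leftPart s i).length = k ∧ residues k (leftPart s i) i = M ∧ rightPart s i = v := by
  rw [Phi]
  simp only [mu_eq_residues]
  constructor
  · intro h
    obtain ⟨rfl, h⟩ := Sigma.mk.inj_iff.1 h
    have h := eq_of_heq h
    exact ⟨rfl, congrArg Prod.fst h, congrArg Prod.snd h⟩
  · rintro ⟨rfl, rfl, rfl⟩
    rfl

theorem mem_Spt_iff {n : ℕ} {s : List ℕ} {i : ℕ} :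
    (s, i) ∈ Spt n ↔ s.length = n ∧ IsLandau s ∧ i < n := by
  rw [Spt, Finset.mem_product, mem_S_iff, Finset.mem_range, and_assoc]

theorem mem_EGZ_iff {n : ℕ} {M : Multiset (ZMod n)} :
    M ∈ EGZ n ↔ M.card = n ∧ M.sum = (n.choose 2 : ZMod n) := by
  rw [EGZ, Set.Finite.mem_toFinset, egzSet]
  rfl

theorem mapsTo_Phi (n : ℕ) : Set.MapsTo Phi (Spt n : Set (List ℕ × ℕ)) (PhiTarget n) := by
  rintro ⟨s, i⟩ h
  obtain ⟨rfl, hs, hi⟩ := mem_Spt_iff.1 h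
  obtain ⟨hu, hv, huv⟩ := hs.leftPart_rightPart_spec hi
  have hlen := congrArg List.length huv
  rw [length_directSum] at hlen
  refine ⟨Nat.one_le_of_lt hu.lt_length, ?_, ?_, mem_S_iff.2 ⟨?_, hv⟩⟩
  · change (leftPart s i).length ≤ _
    omega
  · change mu (leftPart s i) i ∈ EGZ (leftPart s i).length
    rw [mu_eq_residues, mem_EGZ_iff, card_residues, sum_residues, hu.isLandau.sum_eq]
    simp
  · change (rightPart s i).length = s.length - (leftPart s i).length
    omega

theorem injOn_Phi (n : ℕ) : Set.InjOn Phi (Spt n : Set (List ℕ × ℕ)) := by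
  rintro ⟨s, i⟩ h ⟨s', i'⟩ h' heq
  obtain ⟨rfl, hs, hi⟩ := mem_Spt_iff.1 h
  obtain ⟨hl, hs', hi'⟩ := mem_Spt_iff.1 h'
  rw [← hl] at hi'
  obtain ⟨hu, -, huv⟩ := hs.leftPart_rightPart_spec hi
  obtain ⟨hu', -, huv'⟩ := hs'.leftPart_rightPart_spec hi'
  obtain ⟨h1, h2, h3⟩ := Phi_eq_iff.1 heq
  change _ = mu (leftPart s' i') i' at h2
  change _ = (leftPart s' i').length at h1
  change _ = rightPart s' i' at h3
  rw [mu_eq_residues] at h2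
  obtain ⟨h4, rfl⟩ := hu.eq_of_residues_eq hu' h1 rfl h2
  rw [← huv, ← huv', h4, h3]

theorem surjOn_Phi (n : ℕ) : Set.SurjOn Phi (Spt n : Set (List ℕ × ℕ)) (PhiTarget n) := by
  rintro ⟨k, M, v⟩ ⟨hk, hkn, hM, hv⟩
  obtain ⟨hvl, hv⟩ := mem_S_iff.1 hv
  obtain ⟨hMc, hMs⟩ := mem_EGZ_iff.1 hM
  obtain ⟨u, i, hu, hul, hr⟩ := exists_pointsToLast_residues_eq hk hMc hMs
  simp only at hk hkn hvl hul
  obtain ⟨h1, h2⟩ := hu.leftPart_eq_and_rightPart_eq hv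
  refine ⟨(directSum u v, i), mem_Spt_iff.2 ⟨?_, hu.isLandau.directSum hv, ?_⟩,
    Phi_eq_iff.2 ⟨?_, ?_, h2⟩⟩
  · rw [length_directSum]
    omega
  · have := hu.lt_length
    omega
  · rw [h1, hul]
  · rw [h1, hr]

theorem bijOn_Phi (n : ℕ) : Set.BijOn Phi (Spt n : Set (List ℕ × ℕ)) (PhiTarget n) :=
  ⟨mapsTo_Phi n, injOn_Phi n, surjOn_Phi n⟩

theorem count_zero_Phi {n : ℕ} {s : List ℕ} {i : ℕ} (h : (s, i) ∈ Spt n) :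
    (Phi (s, i)).2.1.count 0 = s.count i := by
  obtain ⟨rfl, hs, hi⟩ := mem_Spt_iff.1 h
  obtain ⟨hu, -, huv⟩ := hs.leftPart_rightPart_spec hi
  change (mu (leftPart s i) i).count 0 = _
  rw [mu_eq_residues, count_zero_residues (fun a => hu.isLandau.lt_length) hu.lt_length]
  conv_rhs => rw [← huv, directSum, List.count_append]
  rw [left_eq_add, List.count_eq_zero]
  intro h
  obtain ⟨a, -, ha⟩ := List.mem_map.1 h
  have := hu.lt_length
  omega

/-- The bijection `Φ` on the level of the coefficient polynomials. -/
theorem SptPoly_eq_sum (n : ℕ) :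
    SptPoly n = ∑ k ∈ Finset.Icc 1 n, EGZPoly k * Polynomial.C ((S (n - k)).card : ℤ) := by
  have h1 : SptPoly n = ∑ q ∈ (Finset.Icc 1 n).sigma fun k => EGZ k ×ˢ S (n - k),
      (Polynomial.X : Polynomial ℤ) ^ q.2.1.count 0 := by
    have hcoe : (((Finset.Icc 1 n).sigma fun k => EGZ k ×ˢ S (n - k) : Finset _) :
        Set (Σ k : ℕ, Multiset (ZMod k) × List ℕ)) = PhiTarget n := by
      ext q
      rw [SetLike.mem_coe, Finset.mem_sigma, Finset.mem_Icc, Finset.mem_product, and_assoc]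
      rfl
    have hb := bijOn_Phi n
    rw [← hcoe] at hb
    exact Finset.sum_nbij Phi hb.mapsTo hb.injOn hb.surjOn fun p hp => by
      rw [count_zero_Phi (n := n) (s := p.1) (i := p.2) hp]
  rw [h1, Finset.sum_sigma]
  refine Finset.sum_congr rfl fun k _ => ?_
  rw [Finset.sum_product, EGZPoly, Finset.sum_mul]
  refine Finset.sum_congr rfl fun M _ => ?_
  change ∑ _ ∈ S (n - k), (Polynomial.X : Polynomial ℤ) ^ M.count 0 = _
  rw [Finset.sum_const, nsmul_eq_mul, mul_comm]
  simp

theorem SptGF_eq : SptGF = EGZGF * SGF.map Polynomial.C := by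
  ext1 n
  rw [PowerSeries.coeff_mul, Finset.Nat.sum_antidiagonal_eq_sum_range_succ_mk,
    Finset.sum_range_succ']
  simp only [SptGF, EGZGF, SGF, PowerSeries.coeff_mk, PowerSeries.coeff_map, Nat.add_eq_zero_iff,
    one_ne_zero, and_false, if_false, if_true, zero_mul, add_zero]
  have h0 : (if n = 0 then (0 : Polynomial ℤ) else SptPoly n) = SptPoly n := by
    split_ifs with h
    · rw [h, SptPoly_eq_sum]
      simp
    · rfl
  rw [h0, SptPoly_eq_sum, ← Finset.Ico_add_one_right_eq_Icc, Finset.sum_Ico_eq_sum_range]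
  simp [add_comm]

end ScoreSeq

theorem theorem3 :
    -- the factorization of the generating function
    ScoreSeq.SptGF = ScoreSeq.EGZGF * ScoreSeq.SGF.map Polynomial.C ∧
    -- every score sequence has a unique decomposition into strong summands
    (∀ n : ℕ, ∀ s ∈ ScoreSeq.S n, ∃! ts : List (List ℕ), ScoreSeq.IsStrongDecomposition s ts) ∧
    -- the map built from this decomposition is a bijection that respects the statistics
    (∀ n : ℕ, Set.BijOn ScoreSeq.Phi (ScoreSeq.Spt n : Set (List ℕ × ℕ))
      (ScoreSeq.PhiTarget n)) ∧
    (∀ n : ℕ, ∀ s i, (s, i) ∈ ScoreSeq.Spt n →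
      (ScoreSeq.Phi (s, i)).2.1.count 0 = s.count i) :=
  ⟨ScoreSeq.SptGF_eq,
    fun _ _ hs => (ScoreSeq.mem_S_iff.1 hs).2.existsUnique_isStrongDecomposition,
    ScoreSeq.bijOn_Phi, fun _ _ _ h => ScoreSeq.count_zero_Phi h⟩
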